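/- Let $L^2=L^2(\mathcal T)$ be the real $L^2$ space of a measure space $\mathcal T$, assumed separable, with its usual inner product $\langle\cdot,\cdot\rangle$ and norm $\|\cdot\|$, and equip $L^2\times L^2$ with the norm $\|(x,y)\|=\|x\|\vee\|y\|$. A set is bounded away from $0$ if it misses an open ball around $(0,0)$. Let $[X,Y]$ be a random element of $L^2\times L^2$ with mean zero that is jointly regularly varying with index $-\alpha$ for some $\alpha>2$; that is, there are a sequence $b(n)\to\infty$ and a nonzero Borel measure $\mu$ on $(L^2\times L^2)\setminus\{(0,0)\}$, finite on Borel sets bounded away from $0$ and satisfying $\mu(tA)=t^{-\alpha}\mu(A)$ for all $t>0$ and all Borel sets $A$, such that $$n\,\mathrm{pr}\{(X,Y)/b(n)\in A\}\to\mu(A)\qquad(n\to\infty)$$ for every Borel set $A$ bounded away from $0$ with $\mu(\partial A)=0$. Let $\mu$ be normalized by $\mu\{(x,y):\|x\|\vee\|y\|>1\}=1$. Let $[X_1,Y_1],[X_2,Y_2],\ldots$ be independent copies of $[X,Y]$, put $R_i=\|X_i\|\vee\|Y_i\|$, and for $1\le k\le n$ let $R_{(k)}$ be the $k$th largest of $R_1,\ldots,R_n$.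 Let $k=k(n)$ be integers with $k\to\infty$ and $k/n\to0$ as $n\to\infty$. Then $\langle x,y\rangle$ is $\mu$-integrable over $\{\|x\|\vee\|y\|>1\}$, and $$\hat\sigma_{n,k}=\frac1k\sum_{i=1}^n\Big\langle\frac{X_i}{R_{(k)}},\frac{Y_i}{R_{(k)}}\Big\rangle\,1\{R_i\ge R_{(k)}\}\ \longrightarrow\ \sigma_{XY}=\int_{\|x\|\vee\|y\|>1}\langle x,y\rangle\,\mu(dx,dy)$$ in probability as $n\to\infty$. -/

import Mathlib

open MeasureTheory ProbabilityTheory Filter Topology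

noncomputable section

/-- A set is bounded away from `0` if it misses some open ball centred at `0`. -/
def BoundedAwayFromZero {E : Type*} [SeminormedAddCommGroup E] (A : Set E) : Prop :=
  ∃ ε : ℝ, 0 < ε ∧ Disjoint A (Metric.ball 0 ε)

/-- Membership in the class `M₀` of boundedly finite measures on `E \ {0}`.
A measure on `E \ {0}` is represented by the measure on `E` that extends it by `0` at the origin. -/
structure IsM0 {E : Type*} [SeminormedAddCommGroup E] [MeasurableSpace E]
    (μ : Measure E) : Prop where
  zero_null : μ {0} = 0
  finite_away : ∀ A : Set E, MeasurableSet A → BoundedAwayFromZero A → μ A < ⊤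

/-- `M₀`-convergence: convergence on all measurable sets that are bounded away from `0` and are
continuity sets of the limit. Only sets bounded away from `0` are tested, so a mass of `μs n` at
the origin plays no role. -/
def TendstoM0 {E : Type*} [SeminormedAddCommGroup E] [MeasurableSpace E]
    (μs : ℕ → Measure E) (μ : Measure E) : Prop :=
  ∀ A : Set E, MeasurableSet A → BoundedAwayFromZero A → μ (frontier A) = 0 →
    Tendsto (fun n => μs n A) atTop (𝓝 (μ A))

/-- The random element `Z` is regularly varying with index `-α`, normalizing sequence `b` and
exponent measure `μ`: `b n → ∞`, `μ` is a nonzero measure in `M₀`, and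
`n P(Z / b n ∈ ·) → μ` in `M₀`. The index enters through the homogeneity of `μ`. -/
structure IsRegularlyVarying {E : Type*} [NormedAddCommGroup E] [NormedSpace ℝ E]
    [MeasurableSpace E] {Ω : Type*} [MeasurableSpace Ω] (P : Measure Ω) (Z : Ω → E)
    (α : ℝ) (b : ℕ → ℝ) (μ : Measure E) : Prop where
  index_pos : 0 < α
  tendsto_norming : Tendsto b atTop atTop
  isM0 : IsM0 μ
  ne_zero : μ ≠ 0
  homogeneous : ∀ t : ℝ, 0 < t → ∀ A : Set E, MeasurableSet A → (0 : E) ∉ A →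
    μ ((fun z => t • z) '' A) = ENNReal.ofReal (t ^ (-α)) * μ A
  tendsto : TendstoM0 (fun n => (n : ENNReal) • P.map (fun ω => (b n)⁻¹ • Z ω)) μ

/-- The `k`-th largest of `r 0, …, r (n - 1)`, for `1 ≤ k ≤ n` (so `k = 1` gives the maximum), read
off from the increasing rearrangement of `r`. The value is `0` for other `k`. -/
def kthLargest {n : ℕ} (r : Fin n → ℝ) (k : ℕ) : ℝ :=
  if h : 1 ≤ k ∧ k ≤ n then r (Tuple.sort r ⟨n - k, by omega⟩) else 0

/-- The extremal covariance `∫_{‖x‖ ∨ ‖y‖ > 1} ⟪x, y⟫ μ(dx, dy)`. -/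
def extremalCovariance {H : Type*} [NormedAddCommGroup H] [InnerProductSpace ℝ H]
    [MeasurableSpace H] (μ : Measure (H × H)) : ℝ :=
  ∫ z in {z : H × H | 1 < max ‖z.1‖ ‖z.2‖}, inner ℝ z.1 z.2 ∂μ

/-- The estimator `k⁻¹ ∑ᵢ ⟪xᵢ / R₍ₖ₎, yᵢ / R₍ₖ₎⟫ 1{Rᵢ ≥ R₍ₖ₎}`, `Rᵢ = ‖xᵢ‖ ∨ ‖yᵢ‖`, of a sample
`(x 0, y 0), …, (x (n - 1), y (n - 1))`. -/
def extremalCovarianceEstimator {H : Type*} [NormedAddCommGroup H] [InnerProductSpace ℝ H]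
    {n : ℕ} (k : ℕ) (x y : Fin n → H) : ℝ :=
  let R : Fin n → ℝ := fun i => max ‖x i‖ ‖y i‖
  let Rk : ℝ := kthLargest R k
  (k : ℝ)⁻¹ * ∑ i : Fin n, if Rk ≤ R i then inner ℝ (Rk⁻¹ • x i) (Rk⁻¹ • y i) else 0

end

/-!
On pairs, `‖z‖ = ‖x‖ ∨ ‖y‖` is the norm of `z = (x, y)`, and `⟪x, y⟫` is a continuous function `f z`
with `|f z| ≤ ‖z‖ ^ 2`, homogeneous of degree two. Divide the observations by `B`, the normalizing
constant `b` at the integer part of `n / k`. The rescaled law `κ n` then satisfies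
`(n / k) • κ n → μ` in `M₀` (`IsRegularlyVarying.isTailArray`), and the estimator is
`U⁻² · (1 / k) ∑ f (Zᵢ / B) 1{‖Zᵢ / B‖ ≥ U}` with the random threshold `U = R₍ₖ₎ / B`
(`extremalCovarianceEstimator_eq_rescaled`).

* An average `(1 / k) ∑ Φ (Zᵢ / B)` with `Φ` bounded and supported away from the origin has variance
  of order `1 / k`, because a summand is nonzero only with probability of order `k / n`. By
  Chebyshev's inequality it has the limit of its mean (`tendstoInMeasure_rare_average`). That limit
  is `∫ Φ dμ` when `Φ` is a continuous function cut off to a shell, by the layer cake formula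
  (`tendsto_mul_setIntegral_shell`); homogeneity makes spheres `μ`-null.
* Since `t < U` says that at least `k` of the rescaled norms exceed `t`, and `1 / k` times their
  number tends to `t ^ (-α)`, the threshold `U` tends to `1` (`IsTailArray.tendsto_threshold`).
* Replacing `U` by `1` costs only terms in a thin shell around the unit sphere, whose number is a
  small multiple of `k`.
* Far out, `f` is controlled by a second moment. Regular variation along `b` with `α > 2` forces the
  tail of `‖Z‖` to lose more than a factor `4` at each doubling of a large argument
  (`exists_tail_doubling_bound`), so summing over dyadic shells bounds the truncated second moment
  beyond `M` by a multiple of `M ^ (2 - α)`, uniformly in `n`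
  (`IsTailArray.exists_tail_average_small`). The same summation gives integrability under `μ`.

`IsTailArray.tendsto_threshold_sum` puts these together, and the factor `U⁻²` is removed by
continuity.
-/

/-! ### Order statistics -/

/-- The `k`-th largest value exceeds `t` exactly when at least `k` of the values do. -/
theorem lt_kthLargest_iff {n k : ℕ} (r : Fin n → ℝ) (h1 : 1 ≤ k) (hkn : k ≤ n) (t : ℝ) :
    t < kthLargest r k ↔ k ≤ (Finset.univ.filter fun i => t < r i).card := by
  have hmono : Monotone (r ∘ Tuple.sort r) := Tuple.monotone_sort r
  have hj := Tuple.lt_card_le_iff_apply_le_of_monotone (f := r ∘ Tuple.sort r) (a := t)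
    (j := ⟨n - k, by omega⟩) hmono
  have hperm : (Finset.univ.filter fun i => (r ∘ Tuple.sort r) i ≤ t).card
      = (Finset.univ.filter fun i => r i ≤ t).card :=
    Finset.card_equiv (Tuple.sort r) (by simp)
  have hcompl := Finset.card_filter_add_card_filter_not (s := (Finset.univ : Finset (Fin n)))
    (fun i => r i ≤ t)
  simp only [not_le, Finset.card_univ, Fintype.card_fin] at hcompl
  rw [hperm] at hj
  rw [kthLargest, dif_pos ⟨h1, hkn⟩, ← not_le]
  change ¬ ((r ∘ Tuple.sort r) ⟨n - k, by omega⟩ ≤ t) ↔ _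
  rw [← hj]
  simp only
  omega

/-! ### Homogeneous measures -/

section Homogeneous

variable {E : Type*} [NormedAddCommGroup E]

theorem boundedAwayFromZero_of_subset_norm_gt {A : Set E} {s : ℝ} (hs : 0 < s)
    (h : A ⊆ {z | s ≤ ‖z‖}) : BoundedAwayFromZero A := by
  refine ⟨s, hs, Set.disjoint_left.2 fun z hz hz' => ?_⟩
  have := h hz
  simp only [Set.mem_ofPred_eq, mem_ball_zero_iff] at this hz'
  linarith

variable [MeasurableSpace E] [BorelSpace E]

theorem measurableSet_norm_gt (s : ℝ) : MeasurableSet {z : E | s < ‖z‖} :=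
  measurableSet_lt measurable_const continuous_norm.measurable

variable {μ : Measure E} {α : ℝ}

theorem measure_norm_gt_of_homogeneous [NormedSpace ℝ E]
    (hhom : ∀ t : ℝ, 0 < t → ∀ A : Set E, MeasurableSet A → (0 : E) ∉ A →
      μ ((fun z => t • z) '' A) = ENNReal.ofReal (t ^ (-α)) * μ A)
    (hμ : μ {z | 1 < ‖z‖} = 1) {t : ℝ} (ht : 0 < t) :
    μ {z | t < ‖z‖} = ENNReal.ofReal (t ^ (-α)) := by
  have h := hhom t ht {z | 1 < ‖z‖} (measurableSet_norm_gt 1) (by simp)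
  rw [hμ, mul_one] at h
  rw [← h]
  congr 1
  ext z
  simp only [Set.mem_ofPred_eq, Set.mem_image]
  constructor
  · intro hz
    refine ⟨t⁻¹ • z, ?_, smul_inv_smul₀ ht.ne' z⟩
    rw [norm_smul, Real.norm_of_nonneg (by positivity), inv_mul_eq_div, one_lt_div ht]
    exact hz
  · rintro ⟨y, hy, rfl⟩
    rw [norm_smul, Real.norm_of_nonneg ht.le]
    nlinarith

/-- If the tail of the norm under `μ` is a power, spheres are null because that tail is
continuous. -/
theorem measure_sphere_eq_zero
    (htail : ∀ t : ℝ, 0 < t → μ {z | t < ‖z‖} = ENNReal.ofReal (t ^ (-α)))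
    {t : ℝ} (ht : 0 < t) : μ {z | ‖z‖ = t} = 0 := by
  have hle : ∀ᶠ s in 𝓝[<] t, μ {z | ‖z‖ = t} ≤ ENNReal.ofReal (s ^ (-α) - t ^ (-α)) := by
    filter_upwards [Ioo_mem_nhdsLT (half_lt_self ht)] with s hs
    have hs0 : 0 < s := by linarith [hs.1]
    calc μ {z | ‖z‖ = t} ≤ μ ({z | s < ‖z‖} \ {z | t < ‖z‖}) := by
          refine measure_mono fun z hz => ?_
          simp only [Set.mem_ofPred_eq, Set.mem_sdiff, not_lt] at hz ⊢
          exact ⟨hz ▸ hs.2, hz.le⟩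
      _ = ENNReal.ofReal (s ^ (-α) - t ^ (-α)) := by
          have hsub : {z : E | t < ‖z‖} ⊆ {z | s < ‖z‖} := fun z hz => lt_trans hs.2 hz
          rw [measure_sdiff hsub (measurableSet_norm_gt t).nullMeasurableSet (by rw [htail t ht]; simp),
            htail t ht, htail s hs0, ENNReal.ofReal_sub _ (by positivity)]
  have hlim : Tendsto (fun s : ℝ => ENNReal.ofReal (s ^ (-α) - t ^ (-α))) (𝓝[<] t) (𝓝 0) := by
    have h1 : ContinuousAt (fun s : ℝ => s ^ (-α) - t ^ (-α)) t :=
      (Real.continuousAt_rpow_const t (-α) (Or.inl ht.ne')).sub continuousAt_const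
    have h2 := ENNReal.tendsto_ofReal (h1.tendsto.mono_left (nhdsWithin_le_nhds (s := Set.Iio t)))
    simpa using h2
  exact le_antisymm (ge_of_tendsto hlim hle) zero_le

/-- Integrating the square of the norm over dyadic shells: a geometric decay of the tail at rate
`ρ < 1/4` bounds the truncated second moment by the tail itself. -/
theorem lintegral_norm_sq_le_of_geometric {κ : Measure E} {x ρ : ℝ} {a : ENNReal} (hx : 0 < x)
    (hρ : 0 ≤ ρ) (hρ4 : ρ < 1 / 4)
    (h : ∀ j : ℕ, κ {z | 2 ^ j * x < ‖z‖} ≤ ENNReal.ofReal (ρ ^ j) * a) :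
    ∫⁻ z in {z | x < ‖z‖}, ENNReal.ofReal (‖z‖ ^ 2) ∂κ
      ≤ ENNReal.ofReal (4 / (1 - 4 * ρ) * x ^ 2) * a := by
  have hcover : {z : E | x < ‖z‖} ⊆ ⋃ j : ℕ, {z | 2 ^ j * x < ‖z‖ ∧ ‖z‖ ≤ 2 ^ (j + 1) * x} := by
    intro z hz
    have hz1 : 1 ≤ ‖z‖ / x := by rw [le_div_iff₀ hx]; simpa using hz.le
    obtain ⟨m, hm⟩ : ∃ m : ℕ, ‖z‖ ≤ 2 ^ m * x := by
      obtain ⟨m, hm⟩ := pow_unbounded_of_one_lt (‖z‖ / x) (one_lt_two)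
      exact ⟨m, ((div_lt_iff₀ hx).1 hm).le⟩
    classical
    have hex : ∃ m : ℕ, ‖z‖ ≤ 2 ^ m * x := ⟨m, hm⟩
    have hpos : Nat.find hex ≠ 0 := by
      intro h0
      have := Nat.find_spec hex
      rw [h0] at this
      simp only [Set.mem_ofPred_eq] at hz
      linarith
    obtain ⟨j, hj⟩ := Nat.exists_eq_succ_of_ne_zero hpos
    refine Set.mem_iUnion.2 ⟨j, ?_, ?_⟩
    · exact not_le.1 (Nat.find_min hex (by omega))
    · have := Nat.find_spec hex
      rwa [hj] at this
  have hterm : ∀ j : ℕ, ∫⁻ z in {z | 2 ^ j * x < ‖z‖ ∧ ‖z‖ ≤ 2 ^ (j + 1) * x},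
      ENNReal.ofReal (‖z‖ ^ 2) ∂κ ≤ ENNReal.ofReal (4 * x ^ 2 * (4 * ρ) ^ j) * a := by
    intro j
    have hmeas : MeasurableSet {z : E | 2 ^ j * x < ‖z‖ ∧ ‖z‖ ≤ 2 ^ (j + 1) * x} :=
      (measurableSet_norm_gt _).inter
        (measurableSet_le continuous_norm.measurable measurable_const)
    calc _ ≤ ∫⁻ z in {z | 2 ^ j * x < ‖z‖ ∧ ‖z‖ ≤ 2 ^ (j + 1) * x},
          ENNReal.ofReal ((2 ^ (j + 1) * x) ^ 2) ∂κ := by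
          refine setLIntegral_mono' hmeas fun z hz => ENNReal.ofReal_le_ofReal ?_
          exact pow_le_pow_left₀ (norm_nonneg z) hz.2 2
      _ = ENNReal.ofReal ((2 ^ (j + 1) * x) ^ 2)
          * κ {z | 2 ^ j * x < ‖z‖ ∧ ‖z‖ ≤ 2 ^ (j + 1) * x} := by
          rw [setLIntegral_const]
      _ ≤ ENNReal.ofReal ((2 ^ (j + 1) * x) ^ 2) * (ENNReal.ofReal (ρ ^ j) * a) := by
          gcongr
          exact (measure_mono fun z hz => hz.1).trans (h j)
      _ = ENNReal.ofReal (4 * x ^ 2 * (4 * ρ) ^ j) * a := by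
          rw [← mul_assoc, ← ENNReal.ofReal_mul (by positivity)]
          congr 2
          rw [mul_pow 4 ρ, show (4 : ℝ) = 2 ^ 2 by norm_num, ← pow_mul]
          ring
  have hgeom : HasSum (fun j : ℕ => 4 * x ^ 2 * (4 * ρ) ^ j) (4 * x ^ 2 * (1 - 4 * ρ)⁻¹) :=
    (hasSum_geometric_of_lt_one (by positivity) (by linarith)).mul_left _
  calc _ ≤ ∫⁻ z in ⋃ j : ℕ, {z | 2 ^ j * x < ‖z‖ ∧ ‖z‖ ≤ 2 ^ (j + 1) * x},
        ENNReal.ofReal (‖z‖ ^ 2) ∂κ := lintegral_mono_set hcover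
    _ ≤ ∑' j : ℕ, ∫⁻ z in {z | 2 ^ j * x < ‖z‖ ∧ ‖z‖ ≤ 2 ^ (j + 1) * x},
        ENNReal.ofReal (‖z‖ ^ 2) ∂κ := lintegral_iUnion_le _ _
    _ ≤ ∑' j : ℕ, ENNReal.ofReal (4 * x ^ 2 * (4 * ρ) ^ j) * a := ENNReal.tsum_le_tsum hterm
    _ = ENNReal.ofReal (4 / (1 - 4 * ρ) * x ^ 2) * a := by
        rw [ENNReal.tsum_mul_right, ← ENNReal.ofReal_tsum_of_nonneg
          (fun j => by positivity) hgeom.summable, hgeom.tsum_eq]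
        congr 2
        field_simp

end Homogeneous

/-! ### Regularly varying tails -/

theorem two_rpow_neg_lt {α : ℝ} (hα : 2 < α) : (2 : ℝ) ^ (-α) < 1 / 4 := by
  calc (2 : ℝ) ^ (-α) < 2 ^ (-2 : ℝ) := Real.rpow_lt_rpow_of_exponent_lt one_lt_two (by linarith)
    _ = 1 / 4 := by
      rw [Real.rpow_neg zero_le_two, Real.rpow_two]
      norm_num

/-- A tail function that is regularly varying along the sequence `b` with index `-α < -2` loses
more than a factor `4` whenever its argument is doubled, at every large enough argument and not
only along `b`. This uniform bound is what controls the second moment far out in the tail. -/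
theorem exists_tail_doubling_bound {F : ℝ → ℝ} {b : ℕ → ℝ} {α : ℝ} (hα : 2 < α)
    (hanti : Antitone F) (hF0 : Tendsto F atTop (𝓝 0)) (hb : Tendsto b atTop atTop)
    (hF : ∀ t : ℝ, 0 < t → Tendsto (fun n : ℕ => (n : ℝ) * F (t * b n)) atTop (𝓝 (t ^ (-α)))) :
    ∃ ρ x₀ : ℝ, 0 ≤ ρ ∧ ρ < 1 / 4 ∧ ∀ x, x₀ ≤ x → F (2 * x) ≤ ρ * F x := by
  have hFpos : ∀ x, 0 < F x := by
    intro x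
    have h1 := hF 1 one_pos
    rw [Real.one_rpow] at h1
    obtain ⟨n, hn, hnx⟩ := ((h1.eventually (lt_mem_nhds one_pos)).and
      (hb.eventually (eventually_ge_atTop x))).exists
    rw [one_mul] at hn
    exact (pos_of_mul_pos_right hn n.cast_nonneg).trans_le (hanti hnx)
  have h2α : (2 : ℝ) ^ (-α) < 1 / 4 := two_rpow_neg_lt hα
  -- `s` slightly below `2` leaves room for replacing `x` by a nearby value of `b`.
  obtain ⟨s, ⟨hs1, hs2⟩, hs⟩ : ∃ s : ℝ, s ∈ Set.Ioo 1 2 ∧ s ^ (-α) < 1 / 4 := by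
    have hc : ContinuousAt (fun s : ℝ => s ^ (-α)) 2 :=
      Real.continuousAt_rpow_const 2 (-α) (Or.inl two_ne_zero)
    have := (hc.tendsto.eventually (gt_mem_nhds h2α)).filter_mono
      (nhdsWithin_le_nhds (s := Set.Iio 2))
    have h12 : ∀ᶠ s : ℝ in 𝓝[<] 2, s ∈ Set.Ioo 1 2 := Ioo_mem_nhdsLT one_lt_two
    exact (h12.and this).exists
  obtain ⟨ρ', hρ'1, hρ'2⟩ := exists_between hs
  obtain ⟨ρ, hρ1, hρ2⟩ := exists_between hρ'2
  have hρ'0 : 0 < ρ' := (Real.rpow_pos_of_pos (by linarith) _).trans hρ'1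
  have hρ0 : 0 < ρ := hρ'0.trans hρ1
  have hinv : Tendsto (fun x => (F x)⁻¹) atTop atTop :=
    tendsto_inv_nhdsGT_zero.comp
      (tendsto_nhdsWithin_iff.2 ⟨hF0, Eventually.of_forall hFpos⟩)
  -- The index `N x` satisfies `N x * F x → 1`, so that `b (N x)` is asymptotically `x`.
  set N : ℝ → ℕ := fun x => ⌊(F x)⁻¹⌋₊ with hN
  have hNtop : Tendsto N atTop atTop := tendsto_nat_floor_atTop.comp hinv
  have hNF : Tendsto (fun x => (N x : ℝ) * F x) atTop (𝓝 1) := by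
    have := (tendsto_nat_floor_div_atTop (R := ℝ)).comp hinv
    simpa [Function.comp_def] using this
  have hθ : (1 : ℝ) < (s / 2) ^ (-α) :=
    Real.one_lt_rpow_of_pos_of_lt_one_of_neg (by linarith) (by linarith) (by linarith)
  have e1 := ((hF (s / 2) (by linarith)).comp hNtop).eventually (lt_mem_nhds hθ)
  have e2 := ((hF s (by linarith)).comp hNtop).eventually (gt_mem_nhds hρ'1)
  have e3 := hNF.eventually (lt_mem_nhds (show ρ' / ρ < 1 by rwa [div_lt_one hρ0]))
  obtain ⟨x₀, hx₀⟩ := eventually_atTop.1 (e1.and (e2.and e3))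
  refine ⟨ρ, x₀, hρ0.le, hρ2, fun x hx => ?_⟩
  obtain ⟨h1, h2, h3⟩ := hx₀ x hx
  simp only [Function.comp_apply] at h1 h2
  have hNle : (N x : ℝ) * F x ≤ 1 := by
    have := Nat.floor_le (inv_nonneg.2 (hFpos x).le)
    calc (N x : ℝ) * F x ≤ (F x)⁻¹ * F x := by gcongr; exact (hFpos x).le
      _ = 1 := inv_mul_cancel₀ (hFpos x).ne'
  have hNpos : (0 : ℝ) < N x :=
    pos_of_mul_pos_left ((div_pos hρ'0 hρ0).trans h3) (hFpos x).le
  have hlt : s / 2 * b (N x) < x := by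
    by_contra! hcon
    have := mul_le_mul_of_nonneg_left (hanti hcon) hNpos.le
    linarith
  have hF2 : F (2 * x) ≤ F (s * b (N x)) := hanti (by linarith)
  have h4 : (N x : ℝ) * F (2 * x) ≤ N x * (ρ * F x) := by
    have := mul_le_mul_of_nonneg_left hF2 hNpos.le
    rw [div_lt_iff₀ hρ0] at h3
    nlinarith
  exact le_of_mul_le_mul_left h4 hNpos

theorem geometric_decay_of_doubling_bound {F : ℝ → ℝ} {ρ x₀ : ℝ} (hρ : 0 ≤ ρ) (hx₀ : 0 ≤ x₀)
    (h : ∀ x, x₀ ≤ x → F (2 * x) ≤ ρ * F x) {x : ℝ} (hx : x₀ ≤ x) (j : ℕ) :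
    F (2 ^ j * x) ≤ ρ ^ j * F x := by
  induction j with
  | zero => simp
  | succ j ih =>
    have hle : x₀ ≤ 2 ^ j * x := by
      have : (1 : ℝ) ≤ 2 ^ j := one_le_pow₀ one_le_two
      nlinarith
    calc F (2 ^ (j + 1) * x) = F (2 * (2 ^ j * x)) := by ring_nf
      _ ≤ ρ * F (2 ^ j * x) := h _ hle
      _ ≤ ρ * (ρ ^ j * F x) := by gcongr
      _ = ρ ^ (j + 1) * F x := by ring

/-! ### Convergence of integrals of truncated functions -/

/-- Convergence of the rescaled masses of almost all superlevel sets of a bounded function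
supported in a set of finite measure passes to the integrals, by the layer cake formula and
dominated convergence. -/
theorem tendsto_mul_integral_of_tendsto_superlevel {E : Type*} [MeasurableSpace E]
    {κ : ℕ → Measure E} [∀ n, IsFiniteMeasure (κ n)] {μ : Measure E} {c : ℕ → ℝ} (hc : ∀ n, 0 ≤ c n)
    {S : Set E} (hSμ : μ S ≠ ⊤) {L : ℝ}
    (hSL : Tendsto (fun n => c n * (κ n).real S) atTop (𝓝 L)) {g : E → ℝ} (hg : Measurable g)
    {K : ℝ} (hg0 : ∀ z, 0 ≤ g z) (hgK : ∀ z, g z ≤ K) (hgS : ∀ z, z ∉ S → g z = 0)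
    (h : ∀ᵐ t ∂volume.restrict (Set.Ioi (0 : ℝ)),
      Tendsto (fun n => c n * (κ n).real {z | t < g z}) atTop (𝓝 (μ.real {z | t < g z}))) :
    Tendsto (fun n => c n * ∫ z, g z ∂κ n) atTop (𝓝 (∫ z, g z ∂μ)) := by
  have hint : ∀ η : Measure E, η S ≠ ⊤ → Integrable g η := by
    intro η hη
    have h1 : IntegrableOn g S η :=
      Measure.integrableOn_of_bounded (M := K) hη hg.aestronglyMeasurable
        (Eventually.of_forall fun z => by
          rw [Real.norm_of_nonneg (hg0 z)]; exact hgK z)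
    exact h1.integrable_of_forall_notMem_eq_zero hgS
  have hcake : ∀ η : Measure E, η S ≠ ⊤ →
      ∫ z, g z ∂η = ∫ t in Set.Ioi (0 : ℝ), η.real {z | t < g z} := fun η hη =>
    (hint η hη).integral_eq_integral_meas_lt (Eventually.of_forall hg0)
  rw [hcake μ hSμ]
  simp_rw [fun n => hcake (κ n) (measure_ne_top _ _), ← integral_const_mul]
  refine tendsto_integral_filter_of_dominated_convergence
    ((Set.Iio K).indicator fun _ => L + 1) ?_ ?_ ?_ h
  · refine Eventually.of_forall fun n => Measurable.aestronglyMeasurable ?_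
    refine measurable_const.mul (Antitone.measurable fun s t hst => ?_)
    exact measureReal_mono (fun z hz => lt_of_le_of_lt hst hz)
  · filter_upwards [hSL.eventually (gt_mem_nhds (lt_add_one L))] with n hn
    refine (ae_restrict_iff' measurableSet_Ioi).2 (Eventually.of_forall fun t ht => ?_)
    rw [Real.norm_of_nonneg (mul_nonneg (hc n) measureReal_nonneg)]
    by_cases htK : t < K
    · rw [Set.indicator_of_mem (by exact htK)]
      refine (mul_le_mul_of_nonneg_left (measureReal_mono fun z hz => ?_) (hc n)).trans hn.le
      by_contra hzS
      have h0 := hgS z hzS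
      simp only [Set.mem_ofPred_eq, Set.mem_Ioi] at hz ht
      linarith
    · rw [Set.indicator_of_notMem (by exact htK)]
      have : {z | t < g z} = ∅ := by
        ext z
        simp only [Set.mem_ofPred_eq, Set.mem_empty_iff_false, iff_false, not_lt]
        exact (hgK z).trans (not_lt.1 htK)
      simp [this]
  · rw [integrable_indicator_iff measurableSet_Iio, IntegrableOn,
      Measure.restrict_restrict measurableSet_Iio]
    refine integrableOn_const ?_
    rw [Set.Iio_inter_Ioi]
    simp

section Shell

/-- The shell `{z | s < ‖z‖ ≤ t}`. -/
def shell (E : Type*) [NormedAddCommGroup E] (s t : ℝ) : Set E := {z | s < ‖z‖ ∧ ‖z‖ ≤ t}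

variable {E : Type*} [NormedAddCommGroup E]

theorem frontier_norm_gt_subset (s : ℝ) : frontier {z : E | s < ‖z‖} ⊆ {z | ‖z‖ = s} :=
  (frontier_lt_subset_eq continuous_const continuous_norm).trans fun _ hz => Eq.symm hz

theorem frontier_shell_subset (s t : ℝ) :
    frontier (shell E s t) ⊆ {z | ‖z‖ = s} ∪ {z | ‖z‖ = t} := by
  refine (frontier_inter_subset {z : E | s < ‖z‖} {z | ‖z‖ ≤ t}).trans ?_
  refine Set.union_subset_union ?_ ?_
  · exact Set.inter_subset_left.trans (frontier_norm_gt_subset s)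
  · exact Set.inter_subset_right.trans (frontier_le_subset_eq continuous_norm continuous_const)

variable [MeasurableSpace E] [BorelSpace E]

theorem measurableSet_shell (s t : ℝ) : MeasurableSet (shell E s t) :=
  (measurableSet_norm_gt s).inter (measurableSet_le continuous_norm.measurable measurable_const)

/-- `M₀`-convergence of `c n • κ n` to `μ`, in terms of real numbers, implies convergence of the
integrals of a continuous function over shells. -/
theorem tendsto_mul_setIntegral_shell {κ : ℕ → Measure E} [∀ n, IsFiniteMeasure (κ n)]
    {μ : Measure E} {c : ℕ → ℝ} (hc : ∀ n, 0 ≤ c n)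
    (hfin : ∀ A : Set E, MeasurableSet A → BoundedAwayFromZero A → μ A < ⊤)
    (hconv : ∀ A : Set E, MeasurableSet A → BoundedAwayFromZero A → μ (frontier A) = 0 →
      Tendsto (fun n => c n * (κ n).real A) atTop (𝓝 (μ.real A)))
    (hsphere : ∀ t : ℝ, 0 < t → μ {z | ‖z‖ = t} = 0)
    {f : E → ℝ} (hf : Continuous f) {s t K : ℝ} (hs : 0 < s) (hst : s ≤ t) (hK : 0 ≤ K)
    (hfK : ∀ z ∈ shell E s t, |f z| ≤ K) :
    Tendsto (fun n => c n * ∫ z in shell E s t, f z ∂κ n) atTop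
      (𝓝 (∫ z in shell E s t, f z ∂μ)) := by
  set S := shell E s t
  have hS : MeasurableSet S := measurableSet_shell s t
  have hSge : S ⊆ {z | s ≤ ‖z‖} := fun z hz => hz.1.le
  have hSb : BoundedAwayFromZero S := boundedAwayFromZero_of_subset_norm_gt hs hSge
  have hSfront : μ (frontier S) = 0 :=
    measure_mono_null (frontier_shell_subset s t)
      (measure_union_null (hsphere s hs) (hsphere t (hs.trans_le hst)))
  have hSμ : μ S ≠ ⊤ := (hfin S hS hSb).ne
  have hSL := hconv S hS hSb hSfront
  have hmeas : Measurable (S.indicator fun z => f z + K) :=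
    (hf.measurable.add_const K).indicator hS
  have hge : MeasurableSet {z : E | s ≤ ‖z‖} :=
    measurableSet_le measurable_const continuous_norm.measurable
  have hge_closed : IsClosed {z : E | s ≤ ‖z‖} := isClosed_le continuous_const continuous_norm
  -- The layer cake formula is applied to `f + K`, which is nonnegative on the shell.
  -- All but countably many level sets of `f + K` are null away from the origin.
  have hlevel : ∀ᵐ u : ℝ, μ.restrict {z | s ≤ ‖z‖} {z | f z + K = u} = 0 := by
    have : IsFiniteMeasure (μ.restrict {z | s ≤ ‖z‖}) :=
      ⟨by rw [Measure.restrict_apply_univ]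
          exact hfin _ hge (boundedAwayFromZero_of_subset_norm_gt hs le_rfl)⟩
    have hcount := Measure.countable_meas_level_set_pos (μ := μ.restrict {z | s ≤ ‖z‖})
      (hf.measurable.add_const K)
    refine measure_mono_null (fun u hu => ?_) (hcount.measure_zero volume)
    exact pos_iff_ne_zero.2 hu
  have hmain := tendsto_mul_integral_of_tendsto_superlevel (κ := κ) (μ := μ) hc hSμ hSL hmeas
    (K := 2 * K)
    (fun z => Set.indicator_nonneg (fun z hz => by linarith [(abs_le.1 (hfK z hz)).1]) z)
    (fun z => by
      by_cases hz : z ∈ S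
      · rw [Set.indicator_of_mem hz]; linarith [(abs_le.1 (hfK z hz)).2]
      · rw [Set.indicator_of_notMem hz]
        linarith)
    (fun z hz => Set.indicator_of_notMem hz _)
    (by
      filter_upwards [ae_restrict_of_ae hlevel, ae_restrict_mem measurableSet_Ioi] with u hu hu0
      have hset : {z | u < S.indicator (fun z => f z + K) z} = S ∩ {z | u < f z + K} := by
        ext z
        by_cases hz : z ∈ S
        · simp [hz]
        · simp [hz, (show (0 : ℝ) < u from hu0).le]
      rw [hset]
      refine hconv _ (hS.inter (measurableSet_lt measurable_const (hf.measurable.add_const K)))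
        (boundedAwayFromZero_of_subset_norm_gt hs (Set.inter_subset_left.trans hSge)) ?_
      rw [Measure.restrict_apply' hge] at hu
      refine measure_mono_null (frontier_inter_subset _ _) (measure_union_null
        (measure_mono_null Set.inter_subset_left hSfront) (measure_mono_null ?_ hu))
      rintro z ⟨hz1, hz2⟩
      refine ⟨Eq.symm (frontier_lt_subset_eq continuous_const (hf.add continuous_const) hz2), ?_⟩
      exact closure_minimal hSge hge_closed hz1)
  have hsplit : ∀ η : Measure E, η S ≠ ⊤ →
      ∫ z, S.indicator (fun z => f z + K) z ∂η = (∫ z in S, f z ∂η) + K * η.real S := by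
    intro η hη
    have hint : IntegrableOn f S η :=
      Measure.integrableOn_of_bounded (M := K) hη hf.measurable.aestronglyMeasurable
        ((ae_restrict_iff' hS).2 (Eventually.of_forall hfK))
    rw [integral_indicator hS, integral_add hint (integrableOn_const hη), setIntegral_const,
      smul_eq_mul, mul_comm]
  rw [hsplit μ hSμ] at hmain
  have h2 := hmain.sub (hSL.const_mul K)
  rw [add_sub_cancel_right] at h2
  refine h2.congr fun n => ?_
  rw [hsplit (κ n) (measure_ne_top _ _)]
  ring

end Shell

/-! ### A weak law of large numbers for triangular arrays of rare events -/

/-- A weak law for averages with normalization `k n → ∞` of far more than `k n` summands, each of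
which vanishes outside a set of probability of order `k n / n`. -/
theorem tendstoInMeasure_rare_average {E Ω : Type*} [MeasurableSpace E] [MeasurableSpace Ω]
    {P : Measure Ω} [IsProbabilityMeasure P] {κ : ℕ → Measure E}
    {V : ℕ → ℕ → Ω → E} (hV : ∀ n i, Measurable (V n i)) (hind : ∀ n, iIndepFun (V n) P)
    (hlaw : ∀ n i, P.map (V n i) = κ n)
    {k : ℕ → ℕ} (hk : Tendsto k atTop atTop) {S : Set E} (hS : MeasurableSet S) {a L C : ℝ}
    (hSa : Tendsto (fun n : ℕ => (n : ℝ) / k n * (κ n).real S) atTop (𝓝 a))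
    {Φ : E → ℝ} (hΦ : Measurable Φ) (hΦC : ∀ z, |Φ z| ≤ C) (hΦS : ∀ z, z ∉ S → Φ z = 0)
    (hmean : Tendsto (fun n : ℕ => (n : ℝ) / k n * ∫ z, Φ z ∂κ n) atTop (𝓝 L)) :
    TendstoInMeasure P (fun n ω => (k n : ℝ)⁻¹ * ∑ i : Fin n, Φ (V n i ω)) atTop (fun _ => L) := by
  have hmem : ∀ n i, MemLp (fun ω => Φ (V n i ω)) 2 P := fun n i =>
    MemLp.of_bound (hΦ.comp (hV n i)).aestronglyMeasurable C (Eventually.of_forall fun ω => hΦC _)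
  have hint : ∀ n i, ∫ ω, Φ (V n i ω) ∂P = ∫ z, Φ z ∂κ n := fun n i => by
    rw [← hlaw n i, integral_map (hV n i).aemeasurable hΦ.aestronglyMeasurable]
  set T : ℕ → Ω → ℝ := fun n ω => (k n : ℝ)⁻¹ * ∑ i : Fin n, Φ (V n i ω) with hT
  have hTmem : ∀ n, MemLp (T n) 2 P := fun n =>
    (memLp_finsetSum Finset.univ fun (i : Fin n) _ => hmem n i).const_mul _
  have hTmean : ∀ n, ∫ ω, T n ω ∂P = (n : ℝ) / k n * ∫ z, Φ z ∂κ n := by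
    intro n
    rw [hT]
    simp only
    rw [integral_const_mul, integral_finsetSum Finset.univ
      fun (i : Fin n) _ => (hmem n i).integrable one_le_two]
    simp only [hint, Finset.sum_const, Finset.card_univ, Fintype.card_fin, nsmul_eq_mul]
    ring
  have hsq : ∀ n i, variance (fun ω => Φ (V n i ω)) P ≤ C ^ 2 * (κ n).real S := by
    intro n i
    refine (variance_le_expectation_sq (hmem n i).aestronglyMeasurable).trans ?_
    have hpre : MeasurableSet (V n i ⁻¹' S) := hV n i hS
    calc ∫ ω, ((fun ω => Φ (V n i ω)) ^ 2) ω ∂P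
        ≤ ∫ ω, (V n i ⁻¹' S).indicator (fun _ => C ^ 2) ω ∂P := by
          refine integral_mono (hmem n i).integrable_sq
            ((integrable_const _).indicator hpre) fun ω => ?_
          by_cases hω : V n i ω ∈ S
          · rw [Set.indicator_of_mem (by exact hω)]
            simp only [Pi.pow_apply]
            exact sq_le_sq' (abs_le.1 (hΦC _)).1 (abs_le.1 (hΦC _)).2
          · rw [Set.indicator_of_notMem (by exact hω)]
            simp [hΦS _ hω]
      _ = C ^ 2 * (κ n).real S := by
          rw [integral_indicator hpre, setIntegral_const, smul_eq_mul, mul_comm, ← hlaw n i,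
            map_measureReal_apply (hV n i) hS]
  have hvar : ∀ n, variance (T n) P ≤ (k n : ℝ)⁻¹ * (C ^ 2 * ((n : ℝ) / k n * (κ n).real S)) := by
    intro n
    have hsum : variance (fun ω => ∑ i : Fin n, Φ (V n i ω)) P
        = ∑ i : Fin n, variance (fun ω => Φ (V n i ω)) P := by
      have := IndepFun.variance_sum (μ := P) (s := (Finset.univ : Finset (Fin n)))
        (X := fun (i : Fin n) ω => Φ (V n i ω)) (fun i _ => hmem n i)
        (fun i _ j _ hij => ((hind n).indepFun (Fin.val_injective.ne hij)).comp hΦ hΦ)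
      rw [← this]
      congr 1
      ext ω
      simp
    rw [hT]
    simp only
    rw [variance_const_mul, hsum]
    calc _ ≤ ((k n : ℝ)⁻¹) ^ 2 * ∑ _i : Fin n, C ^ 2 * (κ n).real S := by
          gcongr with i
          exact hsq n i
      _ = _ := by
          simp only [Finset.sum_const, Finset.card_univ, Fintype.card_fin, nsmul_eq_mul]
          ring
  have hvar0 : Tendsto (fun n => variance (T n) P) atTop (𝓝 0) := by
    have hinv : Tendsto (fun n => (k n : ℝ)⁻¹) atTop (𝓝 0) :=
      tendsto_inv_atTop_zero.comp (tendsto_natCast_atTop_atTop.comp hk)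
    have h0 := hinv.mul (hSa.const_mul (C ^ 2))
    rw [zero_mul] at h0
    exact squeeze_zero (fun n => variance_nonneg _ _) hvar h0
  rw [tendstoInMeasure_iff_dist]
  intro ε hε
  have hcheb : ∀ᶠ n in atTop, P {ω | ε ≤ dist (T n ω) L}
      ≤ ENNReal.ofReal (variance (T n) P / (ε / 2) ^ 2) := by
    filter_upwards [(Metric.tendsto_nhds.1 hmean) (ε / 2) (half_pos hε)] with n hn
    rw [← hTmean n] at hn
    refine (measure_mono fun ω hω => ?_).trans
      (meas_ge_le_variance_div_sq (hTmem n) (half_pos hε))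
    simp only [Set.mem_ofPred_eq] at hω ⊢
    rw [← Real.dist_eq]
    linarith [dist_triangle (T n ω) (∫ ω, T n ω ∂P) L]
  have hlim : Tendsto (fun n => ENNReal.ofReal (variance (T n) P / (ε / 2) ^ 2)) atTop (𝓝 0) := by
    have := ENNReal.tendsto_ofReal (hvar0.div_const ((ε / 2) ^ 2))
    simpa using this
  exact tendsto_of_tendsto_of_tendsto_of_le_of_le' tendsto_const_nhds hlim
    (Eventually.of_forall fun _ => zero_le) hcheb

/-! ### Arrays of rescaled observations -/

/-- A triangular array `V n i` of random vectors, independent and with common law `κ n` in row `n`,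
such that `(n / k n) • κ n` converges in `M₀` to a measure `μ` with `μ {t < ‖z‖} = t ^ (-α)`, and
whose tails beyond radius `1` decay geometrically along powers of two at a rate `ρ < 1/4`,
uniformly in large `n`. The observations of a regularly varying sample, divided by the normalizing
constant that belongs to sample size `n / k n`, form such an array. -/
structure IsTailArray {E Ω : Type*} [NormedAddCommGroup E] [MeasurableSpace E]
    [MeasurableSpace Ω] (P : Measure Ω) (V : ℕ → ℕ → Ω → E) (κ : ℕ → Measure E) (k : ℕ → ℕ)
    (μ : Measure E) (α : ℝ) : Prop where
  measurable : ∀ n i, Measurable (V n i)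
  indep : ∀ n, iIndepFun (V n) P
  law : ∀ n i, P.map (V n i) = κ n
  tendsto_k : Tendsto k atTop atTop
  finite_away : ∀ A : Set E, MeasurableSet A → BoundedAwayFromZero A → μ A < ⊤
  tail : ∀ t : ℝ, 0 < t → μ {z | t < ‖z‖} = ENNReal.ofReal (t ^ (-α))
  tendsto : ∀ A : Set E, MeasurableSet A → BoundedAwayFromZero A → μ (frontier A) = 0 →
    Tendsto (fun n : ℕ => (n : ℝ) / k n * (κ n).real A) atTop (𝓝 (μ.real A))
  decay : ∃ ρ : ℝ, 0 ≤ ρ ∧ ρ < 1 / 4 ∧ ∀ᶠ n in atTop, ∀ M : ℝ, 1 ≤ M → ∀ j : ℕ,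
    κ n {z | 2 ^ j * M < ‖z‖} ≤ ENNReal.ofReal (ρ ^ j) * κ n {z | M < ‖z‖}

/-- The average `(1 / k n) ∑ Φ (V n i)` over the first `n` entries of row `n`. -/
noncomputable def rowAverage {E Ω : Type*} (V : ℕ → ℕ → Ω → E) (k : ℕ → ℕ) (Φ : E → ℝ)
    (n : ℕ) (ω : Ω) : ℝ :=
  (k n : ℝ)⁻¹ * ∑ i : Fin n, Φ (V n i ω)

namespace IsTailArray

variable {E Ω : Type*} [NormedAddCommGroup E] [MeasurableSpace E] [MeasurableSpace Ω]
  {P : Measure Ω} {V : ℕ → ℕ → Ω → E} {κ : ℕ → Measure E} {k : ℕ → ℕ} {μ : Measure E} {α : ℝ}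

theorem isProbabilityMeasure [IsProbabilityMeasure P] (h : IsTailArray P V κ k μ α) (n : ℕ) :
    IsProbabilityMeasure (κ n) :=
  h.law n 0 ▸ Measure.isProbabilityMeasure_map (h.measurable n 0).aemeasurable

variable [BorelSpace E]

theorem sphere_null (h : IsTailArray P V κ k μ α) (t : ℝ) (ht : 0 < t) : μ {z | ‖z‖ = t} = 0 :=
  measure_sphere_eq_zero h.tail ht

theorem tendsto_tail (h : IsTailArray P V κ k μ α) {t : ℝ} (ht : 0 < t) :
    Tendsto (fun n : ℕ => (n : ℝ) / k n * (κ n).real {z | t < ‖z‖}) atTop (𝓝 (t ^ (-α))) := by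
  have h1 := h.tendsto {z | t < ‖z‖} (measurableSet_norm_gt t)
    (boundedAwayFromZero_of_subset_norm_gt ht fun z (hz : t < ‖z‖) => hz.le)
    (measure_mono_null (frontier_norm_gt_subset t) (h.sphere_null t ht))
  rwa [Measure.real, h.tail t ht, ENNReal.toReal_ofReal (by positivity)] at h1

theorem measureReal_shell (h : IsTailArray P V κ k μ α) {s t : ℝ} (hs : 0 < s) (hst : s ≤ t) :
    μ.real (shell E s t) = s ^ (-α) - t ^ (-α) := by
  have ht := hs.trans_le hst
  have heq : shell E s t = {z | s < ‖z‖} \ {z | t < ‖z‖} := by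
    ext z
    simp [shell]
  have hsub : {z : E | t < ‖z‖} ⊆ {z | s < ‖z‖} := fun z hz => lt_of_le_of_lt hst hz
  rw [heq, measureReal_sdiff hsub (measurableSet_norm_gt t) (by rw [h.tail s hs]; simp),
    Measure.real, Measure.real, h.tail t ht, h.tail s hs, ENNReal.toReal_ofReal (by positivity),
    ENNReal.toReal_ofReal (by positivity)]

theorem integrableOn_of_norm_le_sq (h : IsTailArray P V κ k μ α) (hα : 2 < α) {f : E → ℝ}
    (hf : Continuous f) (hfsq : ∀ z, |f z| ≤ ‖z‖ ^ 2) : IntegrableOn f {z | 1 < ‖z‖} μ := by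
  have hρ4 : (2 : ℝ) ^ (-α) < 1 / 4 := two_rpow_neg_lt hα
  have hmom := lintegral_norm_sq_le_of_geometric (κ := μ) (x := 1) (ρ := 2 ^ (-α))
    (a := μ {z | 1 < ‖z‖}) one_pos (by positivity) hρ4 (fun j => by
      rw [h.tail _ (by positivity), h.tail 1 one_pos, ← ENNReal.ofReal_mul (by positivity)]
      refine ENNReal.ofReal_le_ofReal (le_of_eq ?_)
      rw [Real.one_rpow, mul_one, mul_one, ← Real.rpow_natCast, ← Real.rpow_natCast,
        ← Real.rpow_mul zero_le_two, ← Real.rpow_mul zero_le_two, mul_comm])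
  refine ⟨hf.measurable.aestronglyMeasurable, lt_of_le_of_lt ?_ (lt_of_le_of_lt hmom ?_)⟩
  · refine lintegral_mono fun z => ?_
    rw [← ofReal_norm]
    exact ENNReal.ofReal_le_ofReal (hfsq z)
  · rw [h.tail 1 one_pos]
    exact ENNReal.mul_lt_top ENNReal.ofReal_lt_top ENNReal.ofReal_lt_top

variable [IsProbabilityMeasure P]

theorem tendsto_count_gt (h : IsTailArray P V κ k μ α) {t : ℝ} (ht : 0 < t) :
    TendstoInMeasure P (rowAverage V k ({z | t < ‖z‖}.indicator fun _ => 1)) atTop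
      (fun _ => t ^ (-α)) := by
  have hS := measurableSet_norm_gt (E := E) t
  refine tendstoInMeasure_rare_average h.measurable h.indep h.law h.tendsto_k hS
    (h.tendsto_tail ht) (C := 1) (measurable_const.indicator hS) (fun z => ?_)
    (fun z hz => Set.indicator_of_notMem hz _) ?_
  · by_cases hz : t < ‖z‖ <;> simp [Set.indicator, hz]
  · refine (h.tendsto_tail ht).congr fun n => ?_
    rw [integral_indicator hS]
    simp

theorem tendsto_shell (h : IsTailArray P V κ k μ α) {f : E → ℝ} (hf : Continuous f) {s t K : ℝ}
    (hs : 0 < s) (hst : s ≤ t) (hfK : ∀ z ∈ shell E s t, |f z| ≤ K) :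
    TendstoInMeasure P (rowAverage V k ((shell E s t).indicator f)) atTop
      (fun _ => ∫ z in shell E s t, f z ∂μ) := by
  have hS := measurableSet_shell (E := E) s t
  have hfK' : ∀ z ∈ shell E s t, |f z| ≤ |K| := fun z hz => (hfK z hz).trans (le_abs_self K)
  have := h.isProbabilityMeasure
  refine tendstoInMeasure_rare_average h.measurable h.indep h.law h.tendsto_k hS
    (h.tendsto _ hS (boundedAwayFromZero_of_subset_norm_gt hs fun z hz => hz.1.le)
      (measure_mono_null (frontier_shell_subset s t)
        (measure_union_null (h.sphere_null s hs) (h.sphere_null t (hs.trans_le hst)))))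
    (C := |K|) (hf.measurable.indicator hS) (fun z => ?_)
    (fun z hz => Set.indicator_of_notMem hz _) ?_
  · by_cases hz : z ∈ shell E s t
    · rw [Set.indicator_of_mem hz]; exact hfK' z hz
    · simp [Set.indicator_of_notMem hz]
  · simp_rw [integral_indicator hS]
    exact tendsto_mul_setIntegral_shell (fun n => by positivity) h.finite_away h.tendsto
      h.sphere_null hf hs hst (abs_nonneg K) hfK'

/-- Beyond a large radius `M`, the average of the squared norms is negligible in probability,
uniformly in large `n`; here `α > 2` is used. -/
theorem exists_tail_average_small (h : IsTailArray P V κ k μ α) (hα : 2 < α) {ε : ℝ} (hε : 0 < ε)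
    {η : ENNReal} (hη : 0 < η) :
    ∀ᶠ M : ℝ in atTop, ∀ᶠ n in atTop,
      P {ω | ε ≤ rowAverage V k ({z | M < ‖z‖}.indicator fun z => ‖z‖ ^ 2) n ω} ≤ η := by
  obtain ⟨ρ, hρ0, hρ4, hdecay⟩ := h.decay
  set D : ℝ := 4 / (1 - 4 * ρ) with hD
  have hD0 : 0 < D := div_pos (by norm_num) (by linarith)
  -- Factor `2` leaves room to replace the rescaled tail at `M` by its limit `M ^ (-α)`.
  have hlim : Tendsto (fun M : ℝ => ENNReal.ofReal (D * (2 * M ^ (-(α - 2))) / ε)) atTop (𝓝 0) := by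
    have h1 := tendsto_rpow_neg_atTop (show 0 < α - 2 by linarith)
    have h2 := ENNReal.tendsto_ofReal (((h1.const_mul 2).const_mul D).div_const ε)
    simpa using h2
  filter_upwards [hlim.eventually (ge_mem_nhds hη), eventually_ge_atTop 1] with M hM hM1
  have hM0 : 0 < M := by linarith
  have hpow : 0 < M ^ (-α) := Real.rpow_pos_of_pos hM0 _
  have hS := measurableSet_norm_gt (E := E) M
  filter_upwards [hdecay, (h.tendsto_tail hM0).eventually
    (gt_mem_nhds (show M ^ (-α) < 2 * M ^ (-α) by linarith))] with n hn hn2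
  have := h.isProbabilityMeasure n
  have hmom := lintegral_norm_sq_le_of_geometric hM0 hρ0 hρ4 (hn M hM1)
  set g : E → ℝ := {z | M < ‖z‖}.indicator fun z => ‖z‖ ^ 2 with hg
  have hgm : Measurable g := (measurable_norm.pow_const 2).indicator hS
  have hg0 : ∀ z, 0 ≤ g z := fun z => Set.indicator_nonneg (fun _ _ => by positivity) z
  have hgV : ∀ i, Measurable fun ω => g (V n i ω) := fun i => hgm.comp (h.measurable n i)
  have hgint : ∀ i, ∫⁻ ω, ENNReal.ofReal (g (V n i ω)) ∂P
      = ∫⁻ z in {z | M < ‖z‖}, ENNReal.ofReal (‖z‖ ^ 2) ∂κ n := by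
    intro i
    rw [← h.law n i, ← lintegral_indicator hS, lintegral_map
      ((measurable_norm.pow_const 2).ennreal_ofReal.indicator hS) (h.measurable n i)]
    refine lintegral_congr fun ω => ?_
    by_cases hz : M < ‖V n i ω‖ <;> simp [g, Set.indicator, hz]
  have hexp : ∫⁻ ω, ENNReal.ofReal (rowAverage V k g n ω) ∂P
      = ENNReal.ofReal ((n : ℝ) / k n) * ∫⁻ z in {z | M < ‖z‖}, ENNReal.ofReal (‖z‖ ^ 2) ∂κ n := by
    have hrw : ∀ ω, ENNReal.ofReal (rowAverage V k g n ω)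
        = ENNReal.ofReal ((k n : ℝ)⁻¹) * ∑ i : Fin n, ENNReal.ofReal (g (V n i ω)) := fun ω => by
      rw [rowAverage, ENNReal.ofReal_mul (by positivity),
        ENNReal.ofReal_sum_of_nonneg fun i _ => hg0 _]
    simp_rw [hrw]
    rw [lintegral_const_mul _ (Finset.measurable_sum Finset.univ fun (i : Fin n) _ =>
        (hgV i).ennreal_ofReal),
      lintegral_finsetSum Finset.univ fun (i : Fin n) _ => (hgV i).ennreal_ofReal]
    simp only [hgint, Finset.sum_const, Finset.card_univ, Fintype.card_fin, nsmul_eq_mul]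
    rw [← mul_assoc, div_eq_inv_mul, ENNReal.ofReal_mul (by positivity), ENNReal.ofReal_natCast]
  have hbound : ∫⁻ ω, ENNReal.ofReal (rowAverage V k g n ω) ∂P
      ≤ ENNReal.ofReal (D * (2 * M ^ (-(α - 2)))) := by
    rw [hexp]
    calc _ ≤ ENNReal.ofReal ((n : ℝ) / k n) * (ENNReal.ofReal (D * M ^ 2) * κ n {z | M < ‖z‖}) := by
          gcongr
      _ = ENNReal.ofReal (D * M ^ 2 * ((n : ℝ) / k n * (κ n).real {z | M < ‖z‖})) := by
          rw [← ofReal_measureReal, mul_left_comm, ← ENNReal.ofReal_mul (by positivity),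
            ← ENNReal.ofReal_mul (by positivity)]
      _ ≤ ENNReal.ofReal (D * M ^ 2 * (2 * M ^ (-α))) := by gcongr
      _ = ENNReal.ofReal (D * (2 * M ^ (-(α - 2)))) := by
          rw [show -(α - 2) = 2 + -α by ring, Real.rpow_add hM0, Real.rpow_two]
          congr 1
          ring
  calc P {ω | ε ≤ rowAverage V k g n ω}
      ≤ P {ω | ENNReal.ofReal ε ≤ ENNReal.ofReal (rowAverage V k g n ω)} :=
        measure_mono fun ω hω => ENNReal.ofReal_le_ofReal hω
    _ ≤ (∫⁻ ω, ENNReal.ofReal (rowAverage V k g n ω) ∂P) / ENNReal.ofReal ε := by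
        refine meas_ge_le_lintegral_div (Measurable.aemeasurable ?_) (by simpa using hε) (by simp)
        exact ((Finset.measurable_sum Finset.univ fun (i : Fin n) _ =>
          hgV i).const_mul _).ennreal_ofReal
    _ ≤ ENNReal.ofReal (D * (2 * M ^ (-(α - 2)))) / ENNReal.ofReal ε := by gcongr
    _ = ENNReal.ofReal (D * (2 * M ^ (-(α - 2))) / ε) := (ENNReal.ofReal_div_of_pos hε).symm
    _ ≤ η := hM

end IsTailArray

/-- Moving the threshold from `1` to `u` with `|u - 1| ≤ δ` and truncating at `M` changes the sum
only by terms in a thin shell around the unit sphere and by terms outside radius `M`. -/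
theorem abs_threshold_sub_shell_le {E : Type*} [NormedAddCommGroup E] {f : E → ℝ}
    (hfsq : ∀ z, |f z| ≤ ‖z‖ ^ 2) {δ u M : ℝ} (hδ : 0 < δ) (hu : |u - 1| ≤ δ) (hM : 1 + δ ≤ M)
    (z : E) :
    |(if u ≤ ‖z‖ then f z else 0) - (shell E 1 M).indicator f z|
      ≤ (1 + δ) ^ 2 * (shell E (1 - 2 * δ) (1 + δ)).indicator (fun _ => 1) z
        + {z : E | M < ‖z‖}.indicator (fun z => ‖z‖ ^ 2) z := by
  obtain ⟨hu1, hu2⟩ := abs_le.1 hu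
  have hfz := hfsq z
  have hz0 := norm_nonneg z
  rcases le_or_gt ‖z‖ (1 - 2 * δ) with h1 | h1
  · rw [if_neg (by linarith), Set.indicator_of_notMem (fun h => by linarith [h.1]),
      Set.indicator_of_notMem (fun h => by linarith [h.1]),
      Set.indicator_of_notMem (s := {z : E | M < ‖z‖}) (fun h : M < ‖z‖ => by linarith)]
    simp
  rcases le_or_gt ‖z‖ (1 + δ) with h2 | h2
  · have h3 : |f z| ≤ (1 + δ) ^ 2 := hfz.trans (pow_le_pow_left₀ hz0 h2 2)
    have h4 : 0 ≤ (1 + δ) ^ 2 := by positivity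
    rw [Set.indicator_of_mem (s := shell E (1 - 2 * δ) (1 + δ)) ⟨h1, h2⟩,
      Set.indicator_of_notMem (s := {z : E | M < ‖z‖}) (fun h : M < ‖z‖ => by linarith),
      mul_one, add_zero]
    by_cases h5 : z ∈ shell E 1 M
    · rw [Set.indicator_of_mem h5]
      split_ifs <;> simpa
    · rw [Set.indicator_of_notMem h5]
      split_ifs <;> simpa
  rw [if_pos (by linarith : u ≤ ‖z‖),
    Set.indicator_of_notMem (s := shell E (1 - 2 * δ) (1 + δ)) (fun h => by linarith [h.2])]
  rcases le_or_gt ‖z‖ M with h3 | h3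
  · rw [Set.indicator_of_mem (s := shell E 1 M) ⟨by linarith, h3⟩,
      Set.indicator_of_notMem (s := {z : E | M < ‖z‖}) (fun h : M < ‖z‖ => by linarith)]
    simp
  · rw [Set.indicator_of_notMem (s := shell E 1 M) (fun h => by linarith [h.2]),
      Set.indicator_of_mem (s := {z : E | M < ‖z‖}) h3]
    simpa using hfz

/-- The continuous mapping theorem for two sequences converging in probability to constants. -/
theorem tendstoInMeasure_const_of_continuousAt {Ω : Type*} [MeasurableSpace Ω] {P : Measure Ω}
    {U G W : ℕ → Ω → ℝ} {u g : ℝ} (hU : TendstoInMeasure P U atTop fun _ => u)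
    (hG : TendstoInMeasure P G atTop fun _ => g) {φ : ℝ × ℝ → ℝ} (hφ : ContinuousAt φ (u, g))
    (hW : ∀ᶠ n in atTop, ∀ ω, W n ω = φ (U n ω, G n ω)) :
    TendstoInMeasure P W atTop fun _ => φ (u, g) := by
  rw [tendstoInMeasure_iff_dist] at *
  intro ε hε
  obtain ⟨δ, hδ, h⟩ := Metric.continuousAt_iff.1 hφ ε hε
  have hsum := (hU δ hδ).add (hG δ hδ)
  rw [add_zero] at hsum
  refine tendsto_of_tendsto_of_tendsto_of_le_of_le' tendsto_const_nhds hsum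
    (Eventually.of_forall fun _ => zero_le) ?_
  filter_upwards [hW] with n hn
  refine (measure_mono fun ω hω => ?_).trans (measure_union_le _ _)
  by_contra hcon
  simp only [Set.mem_union, Set.mem_ofPred_eq, not_or, not_le] at hcon hω
  rw [hn] at hω
  have := h (x := (U n ω, G n ω)) (by rw [Prod.dist_eq]; exact max_lt hcon.1 hcon.2)
  linarith

namespace IsTailArray

variable {E Ω : Type*} [NormedAddCommGroup E] [MeasurableSpace E] [BorelSpace E]
  [MeasurableSpace Ω] {P : Measure Ω} [IsProbabilityMeasure P] {V : ℕ → ℕ → Ω → E}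
  {κ : ℕ → Measure E} {k : ℕ → ℕ} {μ : Measure E} {α : ℝ}

/-- A random threshold that exceeds `t` exactly when at least `k n` entries of the row have norm
above `t` converges to `1` in probability. -/
theorem tendsto_threshold (h : IsTailArray P V κ k μ α) (hα : 0 < α) {U : ℕ → Ω → ℝ}
    (hU : ∀ᶠ n in atTop, ∀ ω t,
      t < U n ω ↔ 1 ≤ rowAverage V k ({z | t < ‖z‖}.indicator fun _ => 1) n ω) :
    TendstoInMeasure P U atTop fun _ => 1 := by
  rw [tendstoInMeasure_iff_dist]
  intro ε hε
  obtain ⟨δ, hδ0, hδ⟩ : ∃ δ : ℝ, 0 < δ ∧ δ < min ε 1 := exists_between (lt_min hε one_pos)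
  have hδε := hδ.trans_le (min_le_left _ _)
  have hδ1 := hδ.trans_le (min_le_right _ _)
  have hup : (1 + δ) ^ (-α) < 1 := Real.rpow_lt_one_of_one_lt_of_neg (by linarith) (by linarith)
  have hlo : 1 < (1 - δ) ^ (-α) :=
    Real.one_lt_rpow_of_pos_of_lt_one_of_neg (by linarith) (by linarith) (by linarith)
  have h1 := tendstoInMeasure_iff_dist.1
    (h.tendsto_count_gt (show 0 < 1 + δ by linarith)) _ (sub_pos.2 hup)
  have h2 := tendstoInMeasure_iff_dist.1
    (h.tendsto_count_gt (show 0 < 1 - δ by linarith)) _ (sub_pos.2 hlo)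
  have hsum := h1.add h2
  rw [add_zero] at hsum
  refine tendsto_of_tendsto_of_tendsto_of_le_of_le' tendsto_const_nhds hsum
    (Eventually.of_forall fun _ => zero_le) ?_
  filter_upwards [hU] with n hn
  refine (measure_mono fun ω hω => ?_).trans (measure_union_le _ _)
  simp only [Set.mem_union, Set.mem_ofPred_eq, Real.dist_eq] at hω ⊢
  rcases le_abs.1 hω with hω | hω
  · left
    have := (hn ω (1 + δ)).1 (by linarith)
    exact le_trans (by linarith) (le_abs_self _)
  · right
    have := mt (hn ω (1 - δ)).2 (by linarith)
    exact le_trans (by linarith) (neg_le_abs _)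

/-- Sums over the entries beyond a random threshold converging to `1` converge in probability to
the integral of the limit measure beyond `1`. -/
theorem tendsto_threshold_sum (h : IsTailArray P V κ k μ α) (hα : 2 < α) {f : E → ℝ}
    (hf : Continuous f) (hfsq : ∀ z, |f z| ≤ ‖z‖ ^ 2) {U : ℕ → Ω → ℝ}
    (hU : TendstoInMeasure P U atTop fun _ => 1) :
    TendstoInMeasure P
      (fun n ω => (k n : ℝ)⁻¹ * ∑ i : Fin n, if U n ω ≤ ‖V n i ω‖ then f (V n i ω) else 0) atTop
      (fun _ => ∫ z in {z | 1 < ‖z‖}, f z ∂μ) := by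
  set σ := ∫ z in {z | 1 < ‖z‖}, f z ∂μ with hσ
  have hint := h.integrableOn_of_norm_le_sq hα hf hfsq
  rw [tendstoInMeasure_iff_dist]
  intro ε hε
  rw [ENNReal.tendsto_nhds_zero]
  intro η hη
  have hη4 : 0 < η / 4 := ENNReal.div_pos hη.ne' (by norm_num)
  -- The truncation radius `M`.
  have hunion : ⋃ m : ℕ, shell E 1 (m : ℝ) = {z | 1 < ‖z‖} := by
    ext z
    simp only [shell, Set.mem_iUnion, Set.mem_ofPred_eq]
    exact ⟨fun ⟨_, hm⟩ => hm.1, fun hz => (exists_nat_ge ‖z‖).imp fun m hm => ⟨hz, hm⟩⟩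
  have hσM : Tendsto (fun m : ℕ => ∫ z in shell E 1 (m : ℝ), f z ∂μ) atTop (𝓝 σ) := by
    rw [hσ, ← hunion]
    refine tendsto_setIntegral_of_monotone (fun m => measurableSet_shell 1 (m : ℝ))
      (fun m m' hm z hz => ⟨hz.1, hz.2.trans (by exact_mod_cast hm)⟩) ?_
    rwa [hunion]
  obtain ⟨m, ⟨hm1, hm2⟩, hm3⟩ := ((((Metric.tendsto_nhds.1 hσM) (ε / 4) (by linarith)).and
    (tendsto_natCast_atTop_atTop.eventually
      (h.exists_tail_average_small hα (show 0 < ε / 4 by linarith) hη4))).and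
    (eventually_ge_atTop 2)).exists
  have hm3' : (2 : ℝ) ≤ m := by exact_mod_cast hm3
  -- The width `δ` of the shell in which the threshold lies.
  obtain ⟨δ, ⟨hδ0, hδ1⟩, hδ⟩ : ∃ δ : ℝ, δ ∈ Set.Ioo 0 (1 / 2) ∧
      (1 + δ) ^ 2 * ((1 - 2 * δ) ^ (-α) - (1 + δ) ^ (-α)) < ε / 8 := by
    have hc : ContinuousAt
        (fun δ : ℝ => (1 + δ) ^ 2 * ((1 - 2 * δ) ^ (-α) - (1 + δ) ^ (-α))) 0 := by
      refine ContinuousAt.mul (by fun_prop) (ContinuousAt.sub ?_ ?_)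
      · exact ContinuousAt.rpow_const (by fun_prop) (Or.inl (by norm_num))
      · exact ContinuousAt.rpow_const (by fun_prop) (Or.inl (by norm_num))
    have h1 := (hc.tendsto.eventually
      (gt_mem_nhds (show _ < ε / 8 by simp; linarith))).filter_mono
      (nhdsWithin_le_nhds (s := Set.Ioi 0))
    have h2 : ∀ᶠ δ : ℝ in 𝓝[>] 0, δ ∈ Set.Ioo 0 (1 / 2) := Ioo_mem_nhdsGT (by norm_num)
    exact (h2.and h1).exists
  have hs0 : 0 < 1 - 2 * δ := by linarith
  have hthin := h.tendsto_shell (f := fun _ => 1) continuous_const (K := 1) hs0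
    (show 1 - 2 * δ ≤ 1 + δ by linarith) (fun z _ => by simp)
  rw [setIntegral_const, h.measureReal_shell hs0 (by linarith), smul_eq_mul, mul_one] at hthin
  have hmain := h.tendsto_shell hf (K := (m : ℝ) ^ 2) one_pos (show (1 : ℝ) ≤ m by linarith)
    (fun z hz => (hfsq z).trans (pow_le_pow_left₀ (norm_nonneg z) hz.2 2))
  have e1 := ENNReal.tendsto_nhds_zero.1 (tendstoInMeasure_iff_dist.1 hU δ hδ0) _ hη4
  have e2 := ENNReal.tendsto_nhds_zero.1
    (tendstoInMeasure_iff_dist.1 hmain (ε / 4) (by linarith)) _ hη4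
  have e3 := ENNReal.tendsto_nhds_zero.1
    (tendstoInMeasure_iff_dist.1 hthin (ε / 8 / (1 + δ) ^ 2) (by positivity)) _ hη4
  filter_upwards [e1, e2, e3, hm2] with n h1 h2 h3 h4
  calc _ ≤ P (({ω | δ ≤ dist (U n ω) 1} ∪ {ω | ε / 4 ≤ dist (rowAverage V k
            ((shell E 1 (m : ℝ)).indicator f) n ω) (∫ z in shell E 1 (m : ℝ), f z ∂μ)}) ∪
          ({ω | ε / 8 / (1 + δ) ^ 2 ≤ dist (rowAverage V k
            ((shell E (1 - 2 * δ) (1 + δ)).indicator fun _ => 1) n ω)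
              ((1 - 2 * δ) ^ (-α) - (1 + δ) ^ (-α))} ∪
           {ω | ε / 4 ≤ rowAverage V k
            ({z | (m : ℝ) < ‖z‖}.indicator fun z => ‖z‖ ^ 2) n ω})) := by
        refine measure_mono fun ω hω => ?_
        by_contra hcon
        simp only [Set.mem_union, Set.mem_ofPred_eq, not_or, not_le] at hcon hω
        obtain ⟨⟨c1, c2⟩, c3, c4⟩ := hcon
        rw [Real.dist_eq] at c1 c2 c3 hm1 hω
        have hdiff : |(k n : ℝ)⁻¹ * (∑ i : Fin n, if U n ω ≤ ‖V n i ω‖ then f (V n i ω) else 0)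
            - rowAverage V k ((shell E 1 (m : ℝ)).indicator f) n ω|
            ≤ (1 + δ) ^ 2 * rowAverage V k
                ((shell E (1 - 2 * δ) (1 + δ)).indicator fun _ => 1) n ω
              + rowAverage V k ({z | (m : ℝ) < ‖z‖}.indicator fun z => ‖z‖ ^ 2) n ω := by
          simp only [rowAverage]
          rw [← mul_sub, ← Finset.sum_sub_distrib, abs_mul, abs_of_nonneg (by positivity),
            mul_left_comm, ← mul_add, Finset.mul_sum, ← Finset.sum_add_distrib]
          refine mul_le_mul_of_nonneg_left ?_ (by positivity)
          refine (Finset.abs_sum_le_sum_abs _ _).trans (Finset.sum_le_sum fun i _ => ?_)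
          exact abs_threshold_sub_shell_le hfsq hδ0 c1.le (by linarith) _
        have c5 : (1 + δ) ^ 2 * rowAverage V k
            ((shell E (1 - 2 * δ) (1 + δ)).indicator fun _ => 1) n ω < ε / 4 := by
          have c6 := (le_abs_self _).trans_lt c3
          rw [lt_div_iff₀ (by positivity)] at c6
          nlinarith
        have := abs_lt.1 c2
        have := abs_lt.1 hm1
        have := abs_le.1 hdiff
        rcases le_abs.1 hω with hω | hω <;> linarith
    _ ≤ (η / 4 + η / 4) + (η / 4 + η / 4) :=
        (measure_union_le _ _).trans (add_le_add
          ((measure_union_le _ _).trans (add_le_add h1 h2))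
          ((measure_union_le _ _).trans (add_le_add h3 h4)))
    _ = η := by
        rw [show (4 : ENNReal) = 2 * 2 by norm_num, ENNReal.div_eq_inv_mul,
          ENNReal.mul_inv (by simp) (by simp), mul_assoc, ← ENNReal.div_eq_inv_mul,
          ← ENNReal.div_eq_inv_mul, ENNReal.add_halves, ENNReal.add_halves]

end IsTailArray

/-! ### Regularly varying samples -/

theorem norm_gt_inv_smul_iff {E : Type*} [NormedAddCommGroup E] [NormedSpace ℝ E] {B : ℝ}
    (hB : 0 < B) (t : ℝ) (z : E) :
    t < ‖B⁻¹ • z‖ ↔ t * B < ‖z‖ := by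
  rw [norm_smul, Real.norm_of_nonneg (by positivity), inv_mul_eq_div, lt_div_iff₀ hB]

section RegularVariation

variable {E Ω₀ : Type*} [NormedAddCommGroup E] [MeasurableSpace E] [MeasurableSpace Ω₀]
  {P₀ : Measure Ω₀} {Z : Ω₀ → E} {α : ℝ} {b : ℕ → ℝ} {μ : Measure E}

theorem tendsto_tail_atTop [BorelSpace E] [IsProbabilityMeasure P₀] (hZ : Measurable Z) :
    Tendsto (fun x : ℝ => P₀.real {ω | x < ‖Z ω‖}) atTop (𝓝 0) := by
  have hn : Measurable fun ω => ‖Z ω‖ := hZ.norm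
  have := Measure.isProbabilityMeasure_map (μ := P₀) hn.aemeasurable
  have h := (tendsto_cdf_atTop (P₀.map fun ω => ‖Z ω‖)).const_sub 1
  rw [sub_self] at h
  refine h.congr fun x => ?_
  rw [cdf_eq_real, ← probReal_compl_eq_one_sub measurableSet_Iic, Set.compl_Iic,
    map_measureReal_apply hn measurableSet_Ioi]
  rfl

variable [NormedSpace ℝ E]

/-- The `M₀`-convergence along the sample size `n` carries over to any rate `c n → ∞` that need
not be an integer, with the normalizing constant at the integer part of `c n`. -/
theorem IsRegularlyVarying.tendsto_real_floor (hRV : IsRegularlyVarying P₀ Z α b μ)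
    {c : ℕ → ℝ} (hc : Tendsto c atTop atTop) {A : Set E} (hA : MeasurableSet A)
    (hA0 : BoundedAwayFromZero A) (hAμ : μ (frontier A) = 0) :
    Tendsto (fun n => c n * (P₀.map fun ω => (b ⌊c n⌋₊)⁻¹ • Z ω).real A) atTop
      (𝓝 (μ.real A)) := by
  have h1 := (ENNReal.tendsto_toReal (hRV.isM0.finite_away A hA hA0).ne).comp
    (hRV.tendsto A hA hA0 hAμ)
  have h2 := h1.comp (tendsto_nat_floor_atTop.comp hc)
  have h3 := ((tendsto_nat_floor_div_atTop (R := ℝ)).comp hc).inv₀ one_ne_zero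
  have h4 := h3.mul h2
  rw [inv_one, one_mul] at h4
  refine h4.congr' ?_
  filter_upwards [hc.eventually (eventually_ge_atTop 1)] with n hn
  have hfl : (⌊c n⌋₊ : ℝ) ≠ 0 := by
    exact_mod_cast (Nat.floor_pos.2 hn).ne'
  simp only [Function.comp_apply, Measure.smul_apply, smul_eq_mul, ENNReal.toReal_mul,
    ENNReal.toReal_natCast]
  rw [Measure.real]
  field_simp

variable [BorelSpace E]

theorem IsRegularlyVarying.tendsto_tail (hRV : IsRegularlyVarying P₀ Z α b μ) (hZ : Measurable Z)
    (hμ : μ {z | 1 < ‖z‖} = 1) {t : ℝ} (ht : 0 < t) :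
    Tendsto (fun n : ℕ => (n : ℝ) * P₀.real {ω | t * b n < ‖Z ω‖}) atTop (𝓝 (t ^ (-α))) := by
  have htail := fun s => measure_norm_gt_of_homogeneous (t := s) hRV.homogeneous hμ
  have h := hRV.tendsto_real_floor tendsto_natCast_atTop_atTop
    (measurableSet_norm_gt t)
    (boundedAwayFromZero_of_subset_norm_gt ht fun z (hz : t < ‖z‖) => hz.le)
    (measure_mono_null (frontier_norm_gt_subset t) (measure_sphere_eq_zero htail ht))
  rw [Measure.real, htail t ht, ENNReal.toReal_ofReal (by positivity)] at h
  refine h.congr' ?_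
  filter_upwards [hRV.tendsto_norming.eventually (eventually_gt_atTop 0)] with n hn
  simp only [Nat.floor_natCast]
  have hm : Measurable fun ω => (b n)⁻¹ • Z ω := hZ.const_smul _
  rw [map_measureReal_apply hm (measurableSet_norm_gt t)]
  simp only [Set.preimage_ofPred_eq, norm_gt_inv_smul_iff hn]

/-- A sample from a regularly varying law, rescaled by the normalizing constant for sample size
`n / k n`, is a tail array. -/
theorem IsRegularlyVarying.isTailArray [IsProbabilityMeasure P₀]
    (hRV : IsRegularlyVarying P₀ Z α b μ) (hZ : Measurable Z)
    (hα : 2 < α) (hμ : μ {z | 1 < ‖z‖} = 1)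
    {Ω : Type*} [MeasurableSpace Ω] {P : Measure Ω} {Zs : ℕ → Ω → E}
    (hZs : ∀ i, Measurable (Zs i)) (hindep : iIndepFun Zs P)
    (hcopy : ∀ i, IdentDistrib (Zs i) Z P P₀) {k : ℕ → ℕ} (hk : Tendsto k atTop atTop)
    (hc : Tendsto (fun n : ℕ => (n : ℝ) / k n) atTop atTop) :
    IsTailArray P (fun n i ω => (b ⌊(n : ℝ) / k n⌋₊)⁻¹ • Zs i ω)
      (fun n => P₀.map fun ω => (b ⌊(n : ℝ) / k n⌋₊)⁻¹ • Z ω) k μ α where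
  measurable n i := (hZs i).const_smul _
  indep n := hindep.comp (fun _ z => (b ⌊(n : ℝ) / k n⌋₊)⁻¹ • z)
    fun _ => measurable_const_smul _
  law n i := ((hcopy i).comp (measurable_const_smul (b ⌊(n : ℝ) / k n⌋₊)⁻¹)).map_eq
  tendsto_k := hk
  finite_away := hRV.isM0.finite_away
  tail _ ht := measure_norm_gt_of_homogeneous hRV.homogeneous hμ ht
  tendsto _ hA hA0 hAμ := hRV.tendsto_real_floor hc hA hA0 hAμ
  decay := by
    obtain ⟨ρ, x₀, hρ0, hρ4, hdouble⟩ := exists_tail_doubling_bound hα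
      (F := fun x => P₀.real {ω | x < ‖Z ω‖})
      (fun x y hxy => measureReal_mono fun ω hω => lt_of_le_of_lt hxy hω)
      (tendsto_tail_atTop hZ) hRV.tendsto_norming fun t ht => hRV.tendsto_tail hZ hμ ht
    refine ⟨ρ, hρ0, hρ4, ?_⟩
    have hB := hRV.tendsto_norming.comp (tendsto_nat_floor_atTop.comp hc)
    filter_upwards [hB.eventually (eventually_gt_atTop 0),
      hB.eventually (eventually_ge_atTop x₀)] with n hn0 hnx M hM j
    simp only [Function.comp_apply] at hn0 hnx
    -- The tail of the rescaled law at `t` is the tail of `‖Z‖` at `t` times the normalizing constant.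
    have hmap : ∀ t : ℝ, (P₀.map fun ω => (b ⌊(n : ℝ) / k n⌋₊)⁻¹ • Z ω) {z | t < ‖z‖}
        = P₀ {ω | t * b ⌊(n : ℝ) / k n⌋₊ < ‖Z ω‖} := fun t => by
      have hm : Measurable fun ω => (b ⌊(n : ℝ) / k n⌋₊)⁻¹ • Z ω := hZ.const_smul _
      rw [Measure.map_apply hm (measurableSet_norm_gt t)]
      simp only [Set.preimage_ofPred_eq, norm_gt_inv_smul_iff hn0]
    have hdec := geometric_decay_of_doubling_bound (F := fun x => P₀.real {ω | x < ‖Z ω‖})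
      hρ0 (le_max_right x₀ 0)
      (fun x hx => hdouble x ((le_max_left _ _).trans hx))
      (x := M * b ⌊(n : ℝ) / k n⌋₊) (max_le (by nlinarith) (by positivity)) j
    rw [hmap, hmap, mul_assoc, ← ofReal_measureReal, ← ofReal_measureReal,
      ← ENNReal.ofReal_mul (by positivity)]
    exact ENNReal.ofReal_le_ofReal hdec

end RegularVariation

/-! ### The estimator in terms of rescaled observations -/

/-- The estimator is scale invariant: it can be computed from observations divided by `B`, with the
threshold `u` equal to the `k`-th largest norm divided by `B`. -/
theorem extremalCovarianceEstimator_eq_rescaled {H : Type*} [NormedAddCommGroup H]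
    [InnerProductSpace ℝ H] {n : ℕ} (k : ℕ) (z : Fin n → H × H) {B : ℝ} (hB : 0 < B) :
    extremalCovarianceEstimator k (fun i => (z i).1) (fun i => (z i).2)
      = ((kthLargest (fun i => ‖z i‖) k / B) ^ 2)⁻¹ * ((k : ℝ)⁻¹ *
        ∑ i : Fin n, if kthLargest (fun i => ‖z i‖) k / B ≤ ‖B⁻¹ • z i‖
          then inner ℝ (B⁻¹ • z i).1 (B⁻¹ • z i).2 else 0) := by
  rw [mul_left_comm, Finset.mul_sum]
  change (k : ℝ)⁻¹ * (∑ i : Fin n, if kthLargest (fun i => ‖z i‖) k ≤ ‖z i‖ then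
    inner ℝ ((kthLargest (fun i => ‖z i‖) k)⁻¹ • (z i).1)
      ((kthLargest (fun i => ‖z i‖) k)⁻¹ • (z i).2) else 0) = _
  congr 1
  refine Finset.sum_congr rfl fun i _ => ?_
  have hiff : kthLargest (fun i => ‖z i‖) k / B ≤ ‖B⁻¹ • z i‖
      ↔ kthLargest (fun i => ‖z i‖) k ≤ ‖z i‖ := by
    rw [norm_smul, Real.norm_of_nonneg (by positivity), inv_mul_eq_div,
      div_le_div_iff_of_pos_right hB]
  simp only [hiff]
  split_ifs
  · rw [Prod.smul_fst, Prod.smul_snd, real_inner_smul_left, real_inner_smul_right,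
      real_inner_smul_left, real_inner_smul_right]
    field_simp
  · simp

theorem lt_kthLargest_div_iff {E Ω : Type*} [NormedAddCommGroup E] [NormedSpace ℝ E]
    {Zs : ℕ → Ω → E} {k : ℕ → ℕ} {B : ℕ → ℝ} {n : ℕ} (hB : 0 < B n) (h1 : 1 ≤ k n) (hkn : k n ≤ n)
    (ω : Ω) (t : ℝ) :
    t < kthLargest (fun i : Fin n => ‖Zs i ω‖) (k n) / B n ↔
      1 ≤ rowAverage (fun n i ω => (B n)⁻¹ • Zs i ω) k ({z | t < ‖z‖}.indicator fun _ => 1) n ω := by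
  have hk0 : (0 : ℝ) < k n := by exact_mod_cast h1
  have hsum : (∑ i : Fin n, {z : E | t < ‖z‖}.indicator (fun _ => (1 : ℝ)) ((B n)⁻¹ • Zs i ω))
      = ((Finset.univ.filter fun i : Fin n => t * B n < ‖Zs i ω‖).card : ℝ) := by
    rw [Finset.card_filter, Nat.cast_sum]
    refine Finset.sum_congr rfl fun i _ => ?_
    by_cases h : t * B n < ‖Zs i ω‖
    · rw [Set.indicator_of_mem (s := {z : E | t < ‖z‖}) ((norm_gt_inv_smul_iff hB t _).2 h), if_pos h,
        Nat.cast_one]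
    · rw [Set.indicator_of_notMem (s := {z : E | t < ‖z‖})
        (mt (norm_gt_inv_smul_iff hB t _).1 h), if_neg h, Nat.cast_zero]
  rw [lt_div_iff₀ hB, lt_kthLargest_iff _ h1 hkn, rowAverage, hsum, inv_mul_eq_div,
    one_le_div hk0, Nat.cast_le]

theorem theorem1
    {T : Type*} [MeasurableSpace T] (τ : Measure T)
    [TopologicalSpace.SeparableSpace (Lp ℝ 2 τ)]
    [MeasurableSpace (Lp ℝ 2 τ)] [BorelSpace (Lp ℝ 2 τ)]
    -- the generic pair `[X, Y]`: mean zero and regularly varying with index `-α`, `α > 2`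
    {Ω₀ : Type*} [MeasurableSpace Ω₀] (P₀ : Measure Ω₀) [IsProbabilityMeasure P₀]
    (X Y : Ω₀ → Lp ℝ 2 τ) (hX : Measurable X) (hY : Measurable Y)
    (hX0 : ∫ ω, X ω ∂P₀ = 0) (hY0 : ∫ ω, Y ω ∂P₀ = 0)
    (α : ℝ) (hα : 2 < α) (b : ℕ → ℝ) (μ : Measure (Lp ℝ 2 τ × Lp ℝ 2 τ))
    (hRV : IsRegularlyVarying P₀ (fun ω => (X ω, Y ω)) α b μ)
    (hμ : μ {z | 1 < max ‖z.1‖ ‖z.2‖} = 1)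
    -- the observations: independent copies of `[X, Y]`
    {Ω : Type*} [MeasurableSpace Ω] (P : Measure Ω) [IsProbabilityMeasure P]
    (Xs Ys : ℕ → Ω → Lp ℝ 2 τ)
    (hXs : ∀ i, Measurable (Xs i)) (hYs : ∀ i, Measurable (Ys i))
    (hindep : iIndepFun (fun i ω => (Xs i ω, Ys i ω)) P)
    (hcopy : ∀ i, IdentDistrib (fun ω => (Xs i ω, Ys i ω)) (fun ω => (X ω, Y ω)) P P₀)
    -- the number of upper order statistics
    (k : ℕ → ℕ) (hk : Tendsto k atTop atTop)
    (hkn : Tendsto (fun n => (k n : ℝ) / (n : ℝ)) atTop (𝓝 0)) :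
    IntegrableOn (fun z : Lp ℝ 2 τ × Lp ℝ 2 τ => (inner ℝ z.1 z.2 : ℝ))
        {z | 1 < max ‖z.1‖ ‖z.2‖} μ ∧
      TendstoInMeasure P
        (fun n ω => extremalCovarianceEstimator (k n)
          (fun i : Fin n => Xs i ω) (fun i : Fin n => Ys i ω))
        atTop (fun _ => extremalCovariance μ) := by

  have : SecondCountableTopology (Lp ℝ 2 τ) := UniformSpace.secondCountable_of_separable _
  have hμ' : μ {z | 1 < ‖z‖} = 1 := hμ
  have hk1 : ∀ᶠ n in atTop, 1 ≤ k n := hk.eventually (eventually_ge_atTop 1)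
  have hc : Tendsto (fun n : ℕ => (n : ℝ) / k n) atTop atTop := by
    have hpos : ∀ᶠ n : ℕ in atTop, (k n : ℝ) / n ∈ Set.Ioi (0 : ℝ) := by
      filter_upwards [hk1, eventually_ge_atTop 1] with n h1 h2
      have hdiv : (0 : ℝ) < (k n : ℝ) / n := div_pos (Nat.cast_pos.2 h1) (Nat.cast_pos.2 h2)
      exact hdiv
    refine (tendsto_inv_nhdsGT_zero.comp (tendsto_nhdsWithin_iff.2 ⟨hkn, hpos⟩)).congr fun n => ?_
    simp
  have hkle : ∀ᶠ n in atTop, k n ≤ n := by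
    filter_upwards [hk1, hc.eventually (eventually_ge_atTop 1)] with n h1 h2
    rw [one_le_div (by exact_mod_cast h1)] at h2
    exact_mod_cast h2
  have hBpos : ∀ᶠ n : ℕ in atTop, 0 < b ⌊(n : ℝ) / k n⌋₊ :=
    (hRV.tendsto_norming.comp (tendsto_nat_floor_atTop.comp hc)).eventually
      (eventually_gt_atTop 0)
  have harr := hRV.isTailArray (hX.prodMk hY) hα hμ' (fun i => (hXs i).prodMk (hYs i)) hindep
    hcopy hk hc
  have hf : Continuous fun z : Lp ℝ 2 τ × Lp ℝ 2 τ => (inner ℝ z.1 z.2 : ℝ) := by fun_prop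
  have hfsq : ∀ z : Lp ℝ 2 τ × Lp ℝ 2 τ, |(inner ℝ z.1 z.2 : ℝ)| ≤ ‖z‖ ^ 2 := fun z =>
    (abs_real_inner_le_norm _ _).trans <| by
      rw [sq]
      exact mul_le_mul (norm_fst_le z) (norm_snd_le z) (norm_nonneg _) (norm_nonneg _)
  -- On pairs, `‖z‖` is by definition the maximum of the two norms.
  refine ⟨harr.integrableOn_of_norm_le_sq hα hf hfsq, ?_⟩
  -- The threshold in rescaled units.
  set U : ℕ → Ω → ℝ := fun n ω =>
    kthLargest (fun i : Fin n => ‖(Xs i ω, Ys i ω)‖) (k n) / b ⌊(n : ℝ) / k n⌋₊ with hUdef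
  have hU : TendstoInMeasure P U atTop fun _ => 1 := by
    refine harr.tendsto_threshold (by linarith) ?_
    filter_upwards [hk1, hkle, hBpos] with n h1 h2 h3 ω t
    exact lt_kthLargest_div_iff (B := fun n : ℕ => b ⌊(n : ℝ) / k n⌋₊)
      (Zs := fun i ω => (Xs i ω, Ys i ω)) h3 h1 h2 ω t
  have hG := harr.tendsto_threshold_sum hα hf hfsq hU
  have hφ : ContinuousAt (fun p : ℝ × ℝ => (p.1 ^ 2)⁻¹ * p.2) (1, extremalCovariance μ) := by
    refine ContinuousAt.mul (ContinuousAt.inv₀ (by fun_prop) (by simp)) (by fun_prop)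
  have hfinal := tendstoInMeasure_const_of_continuousAt hU hG hφ
    (W := fun n ω => extremalCovarianceEstimator (k n)
      (fun i : Fin n => Xs i ω) (fun i : Fin n => Ys i ω)) (by
      filter_upwards [hBpos] with n h3 ω
      exact extremalCovarianceEstimator_eq_rescaled (k n)
        (fun i : Fin n => (Xs i ω, Ys i ω)) h3)
  simp only [one_pow, inv_one, one_mul] at hfinal
  exact hfinal
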